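/- Let $p$ be a prime, let $\mathcal F$ be a saturated fusion system on a finite $p$-group $S$, and let $b\in B(S)$. Then: (a) $b\in B(\mathcal F)$ if and only if $B(\mathrm{Res}^S_P)(b)\in B(P)^{\mathrm{Out}_{\mathcal F}(P)}$ for all subgroups $P\le S$. (b) $b\in B(\mathcal F)$ if and only if $B(\mathrm{Res}^S_R)(b)\in B(R)^{\mathrm{Out}_{\mathcal F}(R)}$ for $R=S$ and for every $\mathcal F$-essential subgroup $R<S$. Here $B(G)$ denotes the Burnside ring of a finite group $G$, that is, the Grothendieck ring of finite left $G$-sets under disjoint union and direct product; for $H\le G$, $b\mapsto|b^H|$ is the ring homomorphism $B(G)\to\mathbb Z$ that maps $[X]$ to the number $|X^H|$ of $H$-fixed points; and $B(\mathrm{Res}^G_H):B(G)\to B(H)$ is the ring homomorphism given by restricting the action to $H$. The ring $B(\mathcal F)$ is the subring of all $b\in B(S)$ such that $|b^P|=|b^Q|$ whenever $P,Q\le S$ are isomorphic in $\mathcal F$. For $P\le S$, $\mathrm{Out}_{\mathcal F}(P)=\mathrm{Aut}_{\mathcal F}(P)/\mathrm{Inn}(P)\le\mathrm{Out}(P)$,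 and $\mathrm{Out}(P)$ acts on $B(P)$ by ring automorphisms: the class of $\alpha\in\mathrm{Aut}(P)$ sends $[X]$ to the class of the set $X$ on which $g\in P$ acts as $\alpha^{-1}(g)$. $B(P)^{\Gamma}$ denotes the subring of elements fixed by $\Gamma\le\mathrm{Out}(P)$. A fusion system $\mathcal F$ on $S$ is a category whose objects are the subgroups of $S$ and whose morphisms are injective group homomorphisms, such that every homomorphism $P\to Q$ induced by conjugation by an element of $S$ is in $\mathcal F$, and every morphism of $\mathcal F$ is an isomorphism in $\mathcal F$ followed by an inclusion. It is saturated if every subgroup of $S$ is $\mathcal F$-conjugate (isomorphic in $\mathcal F$) to some $P$ such that $\mathrm{Aut}_S(P)\in\mathrm{Syl}_p(\mathrm{Aut}_{\mathcal F}(P))$ and every isomorphism $\varphi:Q\to P$ in $\mathcal F$ extends to a morphism $N_\varphi\to S$ in $\mathcal F$, where $N_\varphi=\{g\in N_S(Q):\varphi c_g\varphi^{-1}\in\mathrm{Aut}_S(P)\}$, $c_g$ denotes conjugation by $g$, and $\mathrm{Aut}_S(P)$ is the group of automorphisms of $P$ induced by conjugation by elements of $N_S(P)$. A subgroup $P<S$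 is $\mathcal F$-essential if every $\mathcal F$-conjugate $Q$ of $P$ satisfies $C_S(Q)\le Q$ and $|N_S(Q)|\le|N_S(P)|$, and $\mathrm{Out}_{\mathcal F}(P)$ has a strongly $p$-embedded subgroup, i.e. a proper subgroup $H$ with $p\mid|H|$ such that $p\nmid|H\cap xHx^{-1}|$ for all $x\in\mathrm{Out}_{\mathcal F}(P)\setminus H$. -/

import Mathlib

universe u

/-! ### Finite `G`-sets and their isomorphism classes -/

/-- A finite left `G`-set. -/
structure FinGSet (G : Type u) [Group G] : Type (u + 1) where
  carrier : Type u
  [finite : Finite carrier]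
  [action : MulAction G carrier]

namespace FinGSet

attribute [instance] FinGSet.finite FinGSet.action

/-- Isomorphism of `G`-sets: existence of an equivariant bijection. -/
def Iso {G : Type u} [Group G] (X Y : FinGSet G) : Prop :=
  ∃ e : X.carrier ≃ Y.carrier, ∀ (g : G) (x : X.carrier), e (g • x) = g • e x

instance setoid (G : Type u) [Group G] : Setoid (FinGSet G) where
  r := Iso
  iseqv :=
    { refl := fun _ => ⟨Equiv.refl _, fun _ _ => rfl⟩
      symm := by
        rintro X Y ⟨e, he⟩
        exact ⟨e.symm, fun g y => by rw [Equiv.symm_apply_eq, he, Equiv.apply_symm_apply]⟩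
      trans := by
        rintro X Y Z ⟨e, he⟩ ⟨f, hf⟩
        exact ⟨e.trans f, fun g x => by simp [he, hf]⟩ }

/-- The `G`-set `X ⊔ Y`. -/
def sum {G : Type u} [Group G] (X Y : FinGSet G) : FinGSet G where
  carrier := X.carrier ⊕ Y.carrier

/-- The `G`-set `X × Y` with the diagonal action. -/
def prod {G : Type u} [Group G] (X Y : FinGSet G) : FinGSet G where
  carrier := X.carrier × Y.carrier

/-- The empty `G`-set. -/
def empty (G : Type u) [Group G] : FinGSet G where
  carrier := PEmpty
  action := { smul := fun _ x => x, one_smul := fun _ => rfl, mul_smul := fun _ _ _ => rfl }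

/-- The one-point `G`-set. -/
def point (G : Type u) [Group G] : FinGSet G where
  carrier := PUnit
  action := { smul := fun _ x => x, one_smul := fun _ => rfl, mul_smul := fun _ _ _ => rfl }

/-- The `H`-set obtained from a `G`-set `X` by letting `h` act as `f h`. -/
def pullback {G H : Type u} [Group G] [Group H] (f : H →* G) (X : FinGSet G) : FinGSet H where
  carrier := X.carrier
  action := MulAction.compHom X.carrier f

end FinGSet

/-- Isomorphism classes of finite `G`-sets. -/
def GSetClass (G : Type u) [Group G] : Type (u + 1) := Quotient (FinGSet.setoid G)

namespace GSetClass

variable {G : Type u} [Group G]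

/-- The isomorphism class of a finite `G`-set. -/
def mk (X : FinGSet G) : GSetClass G := Quotient.mk _ X

theorem mk_eq {X Y : FinGSet G} (e : X.carrier ≃ Y.carrier)
    (he : ∀ (g : G) (x : X.carrier), e (g • x) = g • e x) : mk X = mk Y :=
  Quotient.sound ⟨e, he⟩

/-- Addition of isomorphism classes is disjoint union. -/
instance : Add (GSetClass G) where
  add := Quotient.map₂ FinGSet.sum (by
    rintro X X' ⟨e, he⟩ Y Y' ⟨f, hf⟩
    refine ⟨Equiv.sumCongr e f, fun g x => ?_⟩
    rcases x with x | x
    · exact congrArg Sum.inl (he g x)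
    · exact congrArg Sum.inr (hf g x))

/-- Multiplication of isomorphism classes is the product of `G`-sets. -/
instance : Mul (GSetClass G) where
  mul := Quotient.map₂ FinGSet.prod (by
    rintro X X' ⟨e, he⟩ Y Y' ⟨f, hf⟩
    exact ⟨Equiv.prodCongr e f, fun g x => Prod.ext (he g x.1) (hf g x.2)⟩)

instance : Zero (GSetClass G) := ⟨mk (FinGSet.empty G)⟩

instance : One (GSetClass G) := ⟨mk (FinGSet.point G)⟩

instance : CommSemiring (GSetClass G) where
  nsmul := nsmulRec
  npow := npowRec
  add_assoc := by
    rintro ⟨X⟩ ⟨Y⟩ ⟨Z⟩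
    refine mk_eq (Equiv.sumAssoc _ _ _) fun g x => ?_
    rcases x with (x | x) | x <;> rfl
  zero_add := by
    rintro ⟨X⟩
    refine mk_eq (Equiv.emptySum PEmpty X.carrier) fun g x => ?_
    rcases x with x | x
    · exact x.elim
    · rfl
  add_zero := by
    rintro ⟨X⟩
    refine mk_eq (Equiv.sumEmpty X.carrier PEmpty) fun g x => ?_
    rcases x with x | x
    · rfl
    · exact x.elim
  add_comm := by
    rintro ⟨X⟩ ⟨Y⟩
    refine mk_eq (Equiv.sumComm _ _) fun g x => ?_
    rcases x with x | x <;> rfl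
  mul_assoc := by
    rintro ⟨X⟩ ⟨Y⟩ ⟨Z⟩
    exact mk_eq (Equiv.prodAssoc _ _ _) fun g x => rfl
  one_mul := by
    rintro ⟨X⟩
    exact mk_eq (Equiv.punitProd _) fun g x => rfl
  mul_one := by
    rintro ⟨X⟩
    exact mk_eq (Equiv.prodPUnit _) fun g x => rfl
  mul_comm := by
    rintro ⟨X⟩ ⟨Y⟩
    exact mk_eq (Equiv.prodComm _ _) fun g x => rfl
  zero_mul := by
    rintro ⟨X⟩
    exact mk_eq (Equiv.pemptyProd _) fun g x => x.1.elim
  mul_zero := by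
    rintro ⟨X⟩
    exact mk_eq (Equiv.prodPEmpty _) fun g x => x.2.elim
  left_distrib := by
    rintro ⟨X⟩ ⟨Y⟩ ⟨Z⟩
    refine mk_eq (Equiv.prodSumDistrib _ _ _) fun g x => ?_
    rcases x with ⟨x, y | y⟩ <;> rfl
  right_distrib := by
    rintro ⟨X⟩ ⟨Y⟩ ⟨Z⟩
    refine mk_eq (Equiv.sumProdDistrib _ _ _) fun g x => ?_
    rcases x with ⟨x | x, y⟩ <;> rfl

/-- `[X] ↦ [f^* X]`, for a group homomorphism `f : H →* G`. -/
def pullback {G H : Type u} [Group G] [Group H] (f : H →* G) : GSetClass G →+* GSetClass H where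
  toFun := Quotient.map (FinGSet.pullback f) (by
    rintro X Y ⟨e, he⟩
    exact ⟨e, fun h x => he (f h) x⟩)
  map_one' := mk_eq (Equiv.refl PUnit) fun _ _ => rfl
  map_mul' := by
    rintro ⟨X⟩ ⟨Y⟩
    exact mk_eq (Equiv.refl (X.carrier × Y.carrier)) fun _ _ => rfl
  map_zero' := mk_eq (Equiv.refl PEmpty) fun _ _ => rfl
  map_add' := by
    rintro ⟨X⟩ ⟨Y⟩
    refine mk_eq (Equiv.refl (X.carrier ⊕ Y.carrier)) fun g x => ?_
    rcases x with x | x <;> rfl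

/-- `[X] ↦ |X^H|`, the number of fixed points of the subgroup `H`. -/
noncomputable def mark (H : Subgroup G) : GSetClass G →+* ℕ where
  toFun := Quotient.lift (fun X : FinGSet G => Nat.card (MulAction.fixedPoints H X.carrier)) (by
    rintro X Y ⟨e, he⟩
    refine Nat.card_congr (e.subtypeEquiv fun x => ?_)
    refine forall_congr' fun h => ?_
    change (h : G) • x = x ↔ (h : G) • e x = e x
    rw [← he, e.apply_eq_iff_eq])
  map_one' := by
    change Nat.card (MulAction.fixedPoints H (FinGSet.point G).carrier) = 1
    have h : MulAction.fixedPoints H (FinGSet.point G).carrier = Set.univ :=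
      Set.eq_univ_of_forall fun _ _ => rfl
    rw [h]
    exact (Nat.card_congr (Equiv.Set.univ PUnit)).trans Nat.card_unique
  map_zero' := by
    change Nat.card (MulAction.fixedPoints H (FinGSet.empty G).carrier) = 0
    have : IsEmpty (MulAction.fixedPoints H (FinGSet.empty G).carrier) := ⟨fun x => x.1.elim⟩
    exact Nat.card_of_isEmpty
  map_mul' := by
    rintro ⟨X⟩ ⟨Y⟩
    change Nat.card (MulAction.fixedPoints H (X.carrier × Y.carrier)) =
      Nat.card (MulAction.fixedPoints H X.carrier) * Nat.card (MulAction.fixedPoints H Y.carrier)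
    rw [← Nat.card_prod]
    exact Nat.card_congr
      { toFun := fun x => (⟨x.1.1, fun h => congrArg Prod.fst (x.2 h)⟩,
          ⟨x.1.2, fun h => congrArg Prod.snd (x.2 h)⟩)
        invFun := fun x => ⟨(x.1.1, x.2.1), fun h => Prod.ext (x.1.2 h) (x.2.2 h)⟩
        left_inv := fun _ => rfl
        right_inv := fun _ => rfl }
  map_add' := by
    rintro ⟨X⟩ ⟨Y⟩
    change Nat.card (MulAction.fixedPoints H (X.carrier ⊕ Y.carrier)) =
      Nat.card (MulAction.fixedPoints H X.carrier) + Nat.card (MulAction.fixedPoints H Y.carrier)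
    rw [← Nat.card_sum]
    refine Nat.card_congr ((Equiv.subtypeSum).trans (Equiv.sumCongr
      (Equiv.subtypeEquivRight fun x => ?_) (Equiv.subtypeEquivRight fun y => ?_)))
    · exact forall_congr' fun h => Sum.inl_injective.eq_iff (a := h • x) (b := x)
    · exact forall_congr' fun h => Sum.inr_injective.eq_iff (a := h • y) (b := y)

end GSetClass

/-! ### The Grothendieck ring of a commutative semiring -/

/-- The Grothendieck ring of a commutative semiring: formal differences of elements. -/
def GrothendieckRing (R : Type*) [CommSemiring R] : Type _ := Algebra.GrothendieckAddGroup R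

namespace GrothendieckRing

open Algebra

variable {R : Type*} [CommSemiring R]

noncomputable instance : AddCommGroup (GrothendieckRing R) :=
  inferInstanceAs (AddCommGroup (GrothendieckAddGroup R))

/-- The canonical additive map from `R` to its Grothendieck ring. -/
noncomputable def ofAdd : R →+ GrothendieckRing R := GrothendieckAddGroup.of

/-- Additive maps out of the Grothendieck ring. -/
noncomputable def liftAdd {A : Type*} [AddCommGroup A] (f : R →+ A) : GrothendieckRing R →+ A :=
  GrothendieckAddGroup.lift f

theorem liftAdd_ofAdd {A : Type*} [AddCommGroup A] (f : R →+ A) (r : R) :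
    liftAdd f (ofAdd r) = f r :=
  DFunLike.congr_fun (GrothendieckAddGroup.lift.symm_apply_apply f) r

theorem addHom_ext {A : Type*} [AddCommGroup A] {f g : GrothendieckRing R →+ A}
    (h : ∀ r, f (ofAdd r) = g (ofAdd r)) : f = g :=
  GrothendieckAddGroup.lift.symm.injective (AddMonoidHom.ext h)

theorem exists_sub (x : GrothendieckRing R) : ∃ a b : R, x = ofAdd a - ofAdd b := by
  let N : AddSubgroup (GrothendieckRing R) :=
    { carrier := {x | ∃ a b : R, x = ofAdd a - ofAdd b}
      zero_mem' := ⟨0, 0, by simp⟩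
      add_mem' := by
        rintro _ _ ⟨a, b, rfl⟩ ⟨c, d, rfl⟩
        exact ⟨a + c, b + d, by simp only [map_add]; abel⟩
      neg_mem' := by
        rintro _ ⟨a, b, rfl⟩
        exact ⟨b, a, by abel⟩ }
  have h : QuotientAddGroup.mk' N = 0 := addHom_ext fun r => by
    rw [AddMonoidHom.zero_apply]
    exact (QuotientAddGroup.eq_zero_iff _).2 ⟨r, 0, by simp⟩
  exact (QuotientAddGroup.eq_zero_iff x).1 (DFunLike.congr_fun h x)

/-- The biadditive extension of the multiplication of `R`. -/
noncomputable def mulHom : GrothendieckRing R →+ GrothendieckRing R →+ GrothendieckRing R :=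
  liftAdd
    { toFun := fun a => liftAdd (ofAdd.comp (AddMonoidHom.mulLeft a))
      map_zero' := addHom_ext fun r => by simp [liftAdd_ofAdd]
      map_add' := fun a b => addHom_ext fun r => by simp [liftAdd_ofAdd, add_mul] }

noncomputable instance : Mul (GrothendieckRing R) := ⟨fun x y => mulHom x y⟩

noncomputable instance : One (GrothendieckRing R) := ⟨ofAdd 1⟩

theorem ofAdd_mul (a b : R) : ofAdd (a * b) = (ofAdd a * ofAdd b : GrothendieckRing R) := by
  change _ = mulHom (ofAdd a) (ofAdd b)
  simp [mulHom, liftAdd_ofAdd]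

protected theorem add_mul_aux (x y z : GrothendieckRing R) : (x + y) * z = x * z + y * z := by
  change mulHom (x + y) z = mulHom x z + mulHom y z
  simp

protected theorem mul_add_aux (x y z : GrothendieckRing R) : x * (y + z) = x * y + x * z :=
  map_add (mulHom x) y z

protected theorem sub_mul_aux (x y z : GrothendieckRing R) : (x - y) * z = x * z - y * z := by
  change mulHom (x - y) z = mulHom x z - mulHom y z
  simp

protected theorem mul_sub_aux (x y z : GrothendieckRing R) : x * (y - z) = x * y - x * z :=
  map_sub (mulHom x) y z

noncomputable instance : CommRing (GrothendieckRing R) :=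
  { (inferInstance : AddCommGroup (GrothendieckRing R)) with
    left_distrib := GrothendieckRing.mul_add_aux
    right_distrib := GrothendieckRing.add_mul_aux
    zero_mul := fun x => by
      change mulHom 0 x = 0
      simp
    mul_zero := fun x => map_zero (mulHom x)
    mul_assoc := by
      intro x y z
      obtain ⟨a, b, rfl⟩ := exists_sub x
      obtain ⟨c, d, rfl⟩ := exists_sub y
      obtain ⟨e, f, rfl⟩ := exists_sub z
      simp only [GrothendieckRing.sub_mul_aux, GrothendieckRing.mul_sub_aux, ← ofAdd_mul, mul_assoc]
    one_mul := by
      intro x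
      obtain ⟨a, b, rfl⟩ := exists_sub x
      change ofAdd 1 * _ = _
      simp only [GrothendieckRing.mul_sub_aux, ← ofAdd_mul, one_mul]
    mul_one := by
      intro x
      obtain ⟨a, b, rfl⟩ := exists_sub x
      change _ * ofAdd 1 = _
      simp only [GrothendieckRing.sub_mul_aux, ← ofAdd_mul, mul_one]
    mul_comm := by
      intro x y
      obtain ⟨a, b, rfl⟩ := exists_sub x
      obtain ⟨c, d, rfl⟩ := exists_sub y
      simp only [GrothendieckRing.sub_mul_aux, GrothendieckRing.mul_sub_aux, ← ofAdd_mul, mul_comm]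
      abel }

/-- The canonical semiring homomorphism from `R` to its Grothendieck ring. -/
noncomputable def of : R →+* GrothendieckRing R :=
  { ofAdd with
    map_one' := rfl
    map_mul' := ofAdd_mul }

/-- The universal property: semiring homomorphisms to a commutative ring extend. -/
noncomputable def lift {A : Type*} [CommRing A] (f : R →+* A) : GrothendieckRing R →+* A :=
  { liftAdd f.toAddMonoidHom with
    map_one' := (liftAdd_ofAdd f.toAddMonoidHom 1).trans f.map_one
    map_mul' := by
      intro x y
      obtain ⟨a, b, rfl⟩ := exists_sub x
      obtain ⟨c, d, rfl⟩ := exists_sub y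
      change liftAdd f.toAddMonoidHom _ =
        liftAdd f.toAddMonoidHom _ * liftAdd f.toAddMonoidHom _
      simp only [GrothendieckRing.sub_mul_aux, GrothendieckRing.mul_sub_aux, ← ofAdd_mul, map_sub, liftAdd_ofAdd]
      simp [sub_mul, mul_sub] }

theorem lift_of {A : Type*} [CommRing A] (f : R →+* A) (r : R) : lift f (of r) = f r :=
  liftAdd_ofAdd f.toAddMonoidHom r

theorem hom_ext {A : Type*} [CommRing A] {f g : GrothendieckRing R →+* A}
    (h : ∀ r, f (of r) = g (of r)) : f = g :=
  RingHom.coe_addMonoidHom_injective (addHom_ext h)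

end GrothendieckRing

/-! ### The Burnside ring -/

/-- The Burnside ring `B(G)`: the Grothendieck ring of finite `G`-sets. -/
def BurnsideRing (G : Type u) [Group G] : Type (u + 1) := GrothendieckRing (GSetClass G)

namespace BurnsideRing

noncomputable instance (G : Type u) [Group G] : CommRing (BurnsideRing G) :=
  inferInstanceAs (CommRing (GrothendieckRing (GSetClass G)))

/-- The class `[X]` of a finite `G`-set. -/
noncomputable def cls {G : Type u} [Group G] (X : FinGSet G) : BurnsideRing G :=
  GrothendieckRing.of (GSetClass.mk X)

/-- The `H`-component `b ↦ |b^H|` of the ghost map: the ring homomorphism `B(G) → ℤ` that maps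
`[X]` to `|X^H|`. -/
noncomputable def mark {G : Type u} [Group G] (H : Subgroup G) : BurnsideRing G →+* ℤ :=
  GrothendieckRing.lift ((Nat.castRingHom ℤ).comp (GSetClass.mark H))

/-- The ring homomorphism `B(G) → B(H)` induced by letting `H` act on `G`-sets through
`f : H →* G`. -/
noncomputable def pullback {G H : Type u} [Group G] [Group H] (f : H →* G) :
    BurnsideRing G →+* BurnsideRing H :=
  GrothendieckRing.lift ((GrothendieckRing.of).comp (GSetClass.pullback f))

theorem hom_ext {G : Type u} [Group G] {A : Type*} [CommRing A] {f g : BurnsideRing G →+* A}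
    (h : ∀ X, f (cls X) = g (cls X)) : f = g :=
  GrothendieckRing.hom_ext (by rintro ⟨X⟩; exact h X)

theorem pullback_cls {G H : Type u} [Group G] [Group H] (f : H →* G) (X : FinGSet G) :
    pullback f (cls X) = cls (X.pullback f) :=
  GrothendieckRing.lift_of _ _

theorem mark_cls {G : Type u} [Group G] (H : Subgroup G) (X : FinGSet G) :
    mark H (cls X) = Nat.card (MulAction.fixedPoints H X.carrier) :=
  GrothendieckRing.lift_of _ _

theorem pullback_comp {G H K : Type u} [Group G] [Group H] [Group K] (f : H →* G) (g : K →* H) :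
    (pullback g).comp (pullback f) = pullback (f.comp g) :=
  hom_ext fun X => by
    simp only [RingHom.comp_apply, pullback_cls]
    rfl

theorem pullback_id (G : Type u) [Group G] : pullback (MonoidHom.id G) = RingHom.id _ :=
  hom_ext fun X => by
    rw [pullback_cls]
    exact congrArg GrothendieckRing.of (GSetClass.mk_eq (Equiv.refl X.carrier) fun _ _ => rfl)

theorem pullback_conj {G : Type u} [Group G] (g : G) :
    pullback (MulAut.conj g).toMonoidHom = RingHom.id _ :=
  hom_ext fun X => by
    rw [pullback_cls]
    refine congrArg GrothendieckRing.of
      (GSetClass.mk_eq (X := X.pullback _) (MulAction.toPerm g⁻¹ : Equiv.Perm X.carrier)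
        fun h x => ?_)
    have key : ∀ y : X.carrier, g⁻¹ • ((g * h * g⁻¹) • y) = h • (g⁻¹ • y) := fun y => by
      simp [smul_smul, mul_assoc]
    exact key x

/-- Restriction `B(Res^G_H) : B(G) → B(H)`: restrict the action to the subgroup `H`. -/
noncomputable def res {G : Type u} [Group G] (H : Subgroup G) :
    BurnsideRing G →+* BurnsideRing H :=
  pullback H.subtype

/-- The action of `Aut(G)` on `B(G)` by ring automorphisms: `α` acts by transport of structure
`B(Iso(α))`, which maps `[X]` to the class of the set `X` on which `g` acts as `α⁻¹(g)`. -/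
noncomputable def autAction (G : Type u) [Group G] : MulAut G →* RingAut (BurnsideRing G) where
  toFun α := RingEquiv.ofRingHom (pullback α.symm.toMonoidHom) (pullback α.toMonoidHom)
    (by
      rw [pullback_comp, ← pullback_id]
      congr 1
      ext g
      simp)
    (by
      rw [pullback_comp, ← pullback_id]
      congr 1
      ext g
      simp)
  map_one' := RingEquiv.ext fun b => DFunLike.congr_fun (pullback_id G) b
  map_mul' α β := RingEquiv.ext fun b =>
    (DFunLike.congr_fun (pullback_comp β.symm.toMonoidHom α.symm.toMonoidHom) b).symm

end BurnsideRing

/-! ### Outer automorphisms and their action on the Burnside ring -/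

/-- The inner automorphism group `Inn(G)`. -/
def innerAut (G : Type u) [Group G] : Subgroup (MulAut G) := (MulAut.conj : G →* MulAut G).range

instance (G : Type u) [Group G] : (innerAut G).Normal where
  conj_mem := by
    rintro _ ⟨g, rfl⟩ α
    refine ⟨α g, ?_⟩
    ext x
    simp

/-- The outer automorphism group `Out(G) = Aut(G)/Inn(G)`. -/
abbrev OuterAut (G : Type u) [Group G] : Type u := MulAut G ⧸ innerAut G

namespace BurnsideRing

/-- The action of `Out(G)` on `B(G)`, induced by that of `Aut(G)`. -/
noncomputable def outAction (G : Type u) [Group G] : OuterAut G →* RingAut (BurnsideRing G) :=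
  QuotientGroup.lift (innerAut G) (autAction G) (by
    rintro _ ⟨g, rfl⟩
    refine RingEquiv.ext fun b => ?_
    have h : (MulAut.conj g).symm.toMonoidHom = (MulAut.conj g⁻¹).toMonoidHom := by
      ext x
      simp
    change pullback (MulAut.conj g).symm.toMonoidHom b = b
    rw [h, pullback_conj]
    rfl)

noncomputable instance (G : Type u) [Group G] : MulSemiringAction (OuterAut G) (BurnsideRing G) :=
  MulSemiringAction.compHom (BurnsideRing G) (outAction G)

end BurnsideRing

/-! ### Fusion systems -/

/-- The homomorphism `P → Q`, `x ↦ s x s⁻¹`, for `s ∈ S` with `s P s⁻¹ ≤ Q`. -/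
def conjHom {S : Type u} [Group S] {P Q : Subgroup S} (s : S)
    (h : ∀ x ∈ P, s * x * s⁻¹ ∈ Q) : P →* Q where
  toFun x := ⟨s * x * s⁻¹, h x x.2⟩
  map_one' := Subtype.ext (by simp)
  map_mul' x y := Subtype.ext (by simp)

/-- A fusion system on `S`: a category whose objects are the subgroups of `S` and whose morphisms
are injective group homomorphisms (with the usual composition), such that
`Hom_S(P, Q) ⊆ Hom_F(P, Q)`, and every morphism is an isomorphism of the category followed by an
inclusion. (Identities are conjugations by `1`.) -/
structure FusionSystem (S : Type u) [Group S] where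
  /-- the set of morphisms from `P` to `Q` -/
  Hom (P Q : Subgroup S) : Set (P →* Q)
  injective {P Q : Subgroup S} {φ : P →* Q} : φ ∈ Hom P Q → Function.Injective φ
  comp_mem {P Q R : Subgroup S} {φ : P →* Q} {ψ : Q →* R} :
    φ ∈ Hom P Q → ψ ∈ Hom Q R → ψ.comp φ ∈ Hom P R
  conj_mem {P Q : Subgroup S} (s : S) (h : ∀ x ∈ P, s * x * s⁻¹ ∈ Q) : conjHom s h ∈ Hom P Q
  factor {P Q : Subgroup S} {φ : P →* Q} : φ ∈ Hom P Q →
    ∃ (R : Subgroup S) (hR : R ≤ Q) (e : P ≃* R), e.toMonoidHom ∈ Hom P R ∧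
      e.symm.toMonoidHom ∈ Hom R P ∧ φ = (Subgroup.inclusion hR).comp e.toMonoidHom

/-- `Aut_S(P)`: the automorphisms of `P` induced by conjugation by elements of `N_S(P)`. -/
def autS {S : Type u} [Group S] (P : Subgroup S) : Subgroup (MulAut P) :=
  P.normalizerMonoidHom.range

/-- A finite group `G` has a strongly `p`-embedded subgroup: a proper subgroup `H` with
`p ∣ |H|` such that `H ∩ x H x⁻¹` has order prime to `p` for all `x ∈ G \ H`. -/
def HasStronglyEmbedded (p : ℕ) (G : Type u) [Group G] : Prop :=
  ∃ H : Subgroup G, H < ⊤ ∧ p ∣ Nat.card H ∧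
    ∀ x, x ∉ H → ¬ p ∣ Nat.card (H ⊓ H.map (MulAut.conj x).toMonoidHom : Subgroup G)

namespace FusionSystem

variable {S : Type u} [Group S] (F : FusionSystem S)

/-- `Iso_F(P, Q)`: the isomorphisms of the category. -/
def Iso (P Q : Subgroup S) : Set (P ≃* Q) :=
  {e | e.toMonoidHom ∈ F.Hom P Q ∧ e.symm.toMonoidHom ∈ F.Hom Q P}

/-- `P` and `Q` are `F`-conjugate. -/
def Conj (P Q : Subgroup S) : Prop := (F.Iso P Q).Nonempty

/-- `Aut_F(P) = Hom_F(P, P)`, as a group of automorphisms of `P`. -/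
def aut (P : Subgroup S) : Subgroup (MulAut P) where
  carrier := {α | α.toMonoidHom ∈ F.Hom P P}
  mul_mem' {_ _} hα hβ := F.comp_mem hβ hα
  one_mem' := by
    have h := F.conj_mem (P := P) (Q := P) 1 (by simp)
    have e : conjHom 1 (by simp) = (1 : MulAut P).toMonoidHom := by
      ext x
      simp [conjHom]
    rwa [e] at h
  inv_mem' {α} hα := by
    obtain ⟨R, hR, e, -, he, h⟩ := F.factor hα
    have hval : ∀ x : P, ((α x : P) : S) = e x := fun x =>
      congrArg Subtype.val (DFunLike.congr_fun h x)
    obtain rfl : R = P := le_antisymm hR fun x hx => by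
      have := hval (α.symm ⟨x, hx⟩)
      rw [MulEquiv.apply_symm_apply] at this
      rw [show x = _ from this]
      exact (e _).2
    have : α = e := MulEquiv.ext fun x => Subtype.ext (hval x)
    rw [this]
    exact he

/-- `Out_F(P) = Aut_F(P)/Inn(P)`, as a subgroup of `Out(P)`. -/
def out (P : Subgroup S) : Subgroup (OuterAut P) :=
  (F.aut P).map (QuotientGroup.mk' (innerAut P))

/-- `P` is fully automized: `Aut_S(P)` is a Sylow `p`-subgroup of `Aut_F(P)`. -/
def IsFullyAutomized (p : ℕ) (P : Subgroup S) : Prop :=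
  ∃ T : Sylow p (F.aut P), (T : Subgroup (F.aut P)) = (autS P).subgroupOf (F.aut P)

/-- `N_φ = {g ∈ N_S(Q) | φ c_g φ⁻¹ ∈ Aut_S(P)}`, for an isomorphism `φ : Q → P`. -/
def extender {P Q : Subgroup S} (φ : Q ≃* P) : Subgroup S :=
  ((autS P).comap ((MulAut.congr φ).toMonoidHom.comp Q.normalizerMonoidHom)).map
    (Subgroup.normalizer (Q : Set S)).subtype

/-- `P` is receptive: every `φ ∈ Iso_F(Q, P)` extends to a morphism `N_φ → S` of `F`. -/
def IsReceptive (P : Subgroup S) : Prop :=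
  ∀ (Q : Subgroup S) (φ : Q ≃* P), φ ∈ F.Iso Q P →
    ∃ ψ ∈ F.Hom (extender φ) ⊤, ∀ (x : S) (hx : x ∈ Q) (hx' : x ∈ extender φ),
      ((ψ ⟨x, hx'⟩ : (⊤ : Subgroup S)) : S) = φ ⟨x, hx⟩

/-- `F` is saturated: every subgroup is `F`-conjugate to one that is fully automized and
receptive. -/
def IsSaturated (p : ℕ) : Prop :=
  ∀ P : Subgroup S, ∃ Q : Subgroup S, F.Conj P Q ∧ F.IsFullyAutomized p Q ∧ F.IsReceptive Q

/-- `P` is `F`-centric: `C_S(Q) ≤ Q` for all `F`-conjugates `Q` of `P`. -/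
def IsCentric (P : Subgroup S) : Prop :=
  ∀ Q : Subgroup S, F.Conj P Q → Subgroup.centralizer (Q : Set S) ≤ Q

/-- `P` is fully normalized: `|N_S(P)| ≥ |N_S(Q)|` for all `F`-conjugates `Q` of `P`. -/
def IsFullyNormalized (P : Subgroup S) : Prop :=
  ∀ Q : Subgroup S, F.Conj P Q →
    Nat.card (Subgroup.normalizer (Q : Set S)) ≤ Nat.card (Subgroup.normalizer (P : Set S))

/-- `P` is `F`-essential: `P < S` is `F`-centric and fully normalized, and `Out_F(P)` has a
strongly `p`-embedded subgroup. -/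
def IsEssential (p : ℕ) (P : Subgroup S) : Prop :=
  P < ⊤ ∧ F.IsCentric P ∧ F.IsFullyNormalized P ∧ HasStronglyEmbedded p (F.out P)

/-- The Burnside ring `B(F)`: the subring of `B(S)` of all `b` with `|b^P| = |b^Q|` whenever `P`
and `Q` are isomorphic in `F`. -/
def burnsideRing : Subring (BurnsideRing S) where
  carrier := {b | ∀ P Q : Subgroup S, F.Conj P Q →
    BurnsideRing.mark P b = BurnsideRing.mark Q b}
  mul_mem' {a b} ha hb P Q h := by rw [map_mul, map_mul, ha P Q h, hb P Q h]
  one_mem' P Q _ := by rw [map_one, map_one]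
  add_mem' {a b} ha hb P Q h := by rw [map_add, map_add, ha P Q h, hb P Q h]
  zero_mem' P Q _ := by rw [map_zero, map_zero]
  neg_mem' {a} ha P Q h := by rw [map_neg, map_neg, ha P Q h]

end FusionSystem

/-! Everything is a statement about the numbers |b^K|. The ghost map is injective
(`BurnsideRing.eq_of_mark_eq`), so invariance of the restriction of b to P under Out_F(P) means that
K ↦ |b^K| is unchanged when subgroups K ≤ P are moved by Aut_F(P) (`res_mem_subring_iff`).
Membership in B(F) is the same condition for all morphisms of F, since a morphism restricts to an
F-isomorphism from K onto its image (`conj_map`). What remains is a form of Alperin's fusion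
theorem, `preserves_of_essential`, valid for an arbitrary function on subgroups.

That result is proved by downward induction on |P|. Let Q be a fully automized, receptive conjugate
of P. Every conjugate of P has an isomorphism onto Q that extends to its normalizer
(`exists_iso_extends_normalizer`), a strictly larger group, so the induction reduces all
isomorphisms between conjugates of P to Aut_F(Q). An automorphism α with N_α > Q is again covered by
induction. If C_S(Q) is not contained in Q, this applies to every α. Otherwise the automorphisms
preserving the function form a subgroup containing Aut_S(Q) and all α with N_α > Q; if it were
proper, its image would be strongly p-embedded in Out_F(Q) (`hasStronglyEmbedded_out`), so Q would
be essential and the hypothesis would cover Aut_F(Q) after all. -/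

/-! ### The marks determine the elements of the Burnside ring -/

namespace FinGSet

variable {G : Type u} [Group G]

/-- The sub-`G`-set of `X` on a `G`-invariant subset. -/
def sub (X : FinGSet G) (A : Set X.carrier) (hA : ∀ (g : G), ∀ x ∈ A, g • x ∈ A) : FinGSet G where
  carrier := A
  action :=
    { smul := fun g x => ⟨g • x.1, hA g x.1 x.2⟩
      one_smul := fun x => Subtype.ext (one_smul G x.1)
      mul_smul := fun g h x => Subtype.ext (mul_smul g h x.1) }

/-- The transitive `G`-set `G ⧸ H`. -/
def coset [Finite G] (H : Subgroup G) : FinGSet G where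
  carrier := G ⧸ H

end FinGSet

namespace GSetClass

variable {G : Type u} [Group G]

theorem mark_mk (H : Subgroup G) (X : FinGSet G) :
    mark H (mk X) = Nat.card (MulAction.fixedPoints H X.carrier) :=
  rfl

theorem mark_bot_mk (X : FinGSet G) : mark ⊥ (mk X) = Nat.card X.carrier := by
  rw [mark_mk]
  refine Nat.card_congr ⟨fun x => x.1, fun x => ⟨x, ?_⟩, fun _ => rfl, fun _ => rfl⟩
  rintro ⟨g, hg⟩
  obtain rfl := Subgroup.mem_bot.1 hg
  exact one_smul G x

theorem mk_eq_sub_add_sub_compl (X : FinGSet G) (A : Set X.carrier)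
    (hA : ∀ (g : G), ∀ x ∈ A, g • x ∈ A) (hA' : ∀ (g : G), ∀ x ∈ Aᶜ, g • x ∈ Aᶜ) :
    mk X = mk (X.sub A hA) + mk (X.sub Aᶜ hA') := by
  classical
  refine (mk_eq (X := (X.sub A hA).sum (X.sub Aᶜ hA')) (Equiv.Set.sumCompl A) fun g x => ?_).symm
  rcases x with x | x <;> rfl

/-- Splitting off the orbit of a point. -/
theorem exists_mk_eq_coset_add [Finite G] (X : FinGSet G) (x : X.carrier) :
    ∃ Y : FinGSet G, Nat.card Y.carrier < Nat.card X.carrier ∧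
      mk X = mk (FinGSet.coset (MulAction.stabilizer G x)) + mk Y := by
  have hA : ∀ (g : G), ∀ y ∈ MulAction.orbit G x, g • y ∈ MulAction.orbit G x :=
    fun g y hy => (MulAction.mem_orbit_of_mem_orbit g hy)
  have hA' : ∀ (g : G), ∀ y ∈ (MulAction.orbit G x)ᶜ, g • y ∈ (MulAction.orbit G x)ᶜ :=
    fun g y hy h => hy (by simpa using MulAction.mem_orbit_of_mem_orbit g⁻¹ h)
  refine ⟨X.sub _ hA', ?_, ?_⟩
  · refine Set.ncard_lt_card fun h => ?_
    have hx : x ∈ (MulAction.orbit G x)ᶜ := h ▸ Set.mem_univ x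
    exact hx (MulAction.mem_orbit_self x)
  · rw [mk_eq_sub_add_sub_compl X _ hA hA']
    congr 1
    refine (mk_eq (X := FinGSet.coset (MulAction.stabilizer G x))
      (Y := X.sub _ hA) (MulAction.orbitEquivQuotientStabilizer G x).symm fun g y => ?_).symm
    induction y using QuotientGroup.induction_on with
    | H h => exact Subtype.ext (mul_smul g h x)

/-- A point fixed by `H` has stabilizer at least `H`, and a larger stabilizer would itself have a
fixed point, against maximality. -/
theorem exists_stabilizer_eq {X : FinGSet G} {H : Subgroup G} (h0 : mark H (mk X) ≠ 0)
    (hmax : ∀ K, H < K → mark K (mk X) = 0) :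
    ∃ x : X.carrier, MulAction.stabilizer G x = H := by
  rw [mark_mk, Nat.card_ne_zero] at h0
  obtain ⟨⟨x, hx⟩⟩ := h0.1
  have hle : H ≤ MulAction.stabilizer G x := fun g hg => hx ⟨g, hg⟩
  refine ⟨x, (hle.eq_or_lt.resolve_right fun hlt => ?_).symm⟩
  refine (Nat.card_ne_zero (α := MulAction.fixedPoints (MulAction.stabilizer G x) X.carrier)).2
    ⟨⟨x, fun g => g.2⟩, inferInstance⟩ (hmax _ hlt)

/-- Finite `G`-sets with the same marks are isomorphic. -/
theorem eq_of_mark_eq [Finite G] {a b : GSetClass G} (h : ∀ H, mark H a = mark H b) : a = b := by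
  obtain ⟨X, rfl⟩ := Quotient.exists_rep a
  obtain ⟨Y, rfl⟩ := Quotient.exists_rep b
  change ∀ H, mark H (mk X) = mark H (mk Y) at h
  change mk X = mk Y
  induction hn : Nat.card X.carrier using Nat.strong_induction_on generalizing X Y with
  | _ n ih =>
  subst hn
  have hcard : Nat.card X.carrier = Nat.card Y.carrier := by
    rw [← mark_bot_mk, ← mark_bot_mk, h]
  rcases isEmpty_or_nonempty X.carrier with hX | hX
  · have hY : IsEmpty Y.carrier := by
      rw [Nat.card_of_isEmpty, eq_comm, Nat.card_eq_zero] at hcard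
      exact hcard.resolve_right (not_infinite_iff_finite.2 inferInstance)
    exact mk_eq (Equiv.equivOfIsEmpty _ _) fun _ x => hX.elim x
  -- A maximal `H` with nonzero mark is a point stabilizer in both sets, because the marks agree.
  -- Both therefore contain an orbit `G ⧸ H`, which is removed before the induction continues.
  · obtain ⟨H, hH0, hmax⟩ : ∃ H : Subgroup G, mark H (mk X) ≠ 0 ∧
        ∀ K, H < K → mark K (mk X) = 0 := by
      have hne : {H : Subgroup G | mark H (mk X) ≠ 0}.Nonempty :=
        ⟨⊥, by rw [Set.mem_ofPred_eq, mark_bot_mk]; exact Nat.card_pos.ne'⟩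
      obtain ⟨H, hH⟩ := (Set.toFinite {H : Subgroup G | mark H (mk X) ≠ 0}).exists_maximal hne
      exact ⟨H, hH.prop, fun K hK => by_contra fun h0 => hH.not_gt h0 hK⟩
    obtain ⟨x, hx⟩ := exists_stabilizer_eq hH0 hmax
    obtain ⟨y, hy⟩ := exists_stabilizer_eq (X := Y) (h H ▸ hH0) fun K hK => (h K) ▸ hmax K hK
    obtain ⟨X', hX', eX⟩ := exists_mk_eq_coset_add X x
    obtain ⟨Y', -, eY⟩ := exists_mk_eq_coset_add Y y
    rw [hx] at eX
    rw [hy] at eY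
    rw [eX, eY, ih _ hX' X' Y' (fun K => ?_) rfl]
    have hK := h K
    rw [eX, eY, map_add, map_add] at hK
    exact Nat.add_left_cancel hK

end GSetClass

/-! ### Passage from `G`-sets to formal differences -/

theorem GrothendieckRing.ofAdd_sub_eq_ofAdd_sub {R : Type*} [CommSemiring R] {a b c d : R}
    (h : a + d = c + b) : (ofAdd a - ofAdd b : GrothendieckRing R) = ofAdd c - ofAdd d := by
  rw [sub_eq_sub_iff_add_eq_add, ← map_add, ← map_add, h]

namespace BurnsideRing

variable {G : Type u} [Group G]

/-- The ghost map is injective. -/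
theorem eq_of_mark_eq [Finite G] {a b : BurnsideRing G} (h : ∀ H, mark H a = mark H b) :
    a = b := by
  obtain ⟨x, y, rfl⟩ := GrothendieckRing.exists_sub a
  obtain ⟨z, w, rfl⟩ := GrothendieckRing.exists_sub b
  have hof : ∀ (H : Subgroup G) (r : GSetClass G),
      mark H (GrothendieckRing.ofAdd r : GrothendieckRing (GSetClass G)) = (GSetClass.mark H r : ℤ) :=
    fun H r => GrothendieckRing.lift_of _ r
  -- Cross-adding turns an equality of differences into one between genuine `G`-sets, to which the
  -- previous result applies.
  have key : x + w = z + y := GSetClass.eq_of_mark_eq fun H => by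
    have hH := h H
    erw [map_sub, map_sub] at hH
    rw [hof, hof, hof, hof] at hH
    rw [map_add, map_add]
    lia
  exact GrothendieckRing.ofAdd_sub_eq_ofAdd_sub key

/-- `K` acts through its image under `f`, so the two fixed-point sets coincide. -/
theorem mark_pullback {H : Type u} [Group H] (f : H →* G) (K : Subgroup H) (b : BurnsideRing G) :
    mark K (pullback f b) = mark (K.map f) b := by
  refine DFunLike.congr_fun (hom_ext (f := (mark K).comp (pullback f)) (g := mark (K.map f))
    fun X => ?_) b
  rw [RingHom.comp_apply, pullback_cls, mark_cls, mark_cls]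
  congr 1
  refine Nat.card_congr (Equiv.subtypeEquivRight fun x => ⟨fun hx => ?_, fun hx k => ?_⟩)
  · rintro ⟨_, k, hk, rfl⟩
    exact hx ⟨k, hk⟩
  · exact hx ⟨f k, k, k.2, rfl⟩

end BurnsideRing

/-! ### A criterion for strongly embedded subgroups -/

/-- A proper subgroup that contains a nontrivial Sylow `p`-subgroup `T` and every element which
conjugates some nontrivial element of `T` into `T` is strongly `p`-embedded. -/
theorem HasStronglyEmbedded.of_sylow {p : ℕ} [Fact p.Prime] {G : Type u} [Group G] [Finite G]
    (T : Sylow p G) (hT : (T : Subgroup G) ≠ ⊥) (H : Subgroup G) (hTH : (T : Subgroup G) ≤ H)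
    (hH : H < ⊤) (h : ∀ z : G, ∀ t ∈ T, t ≠ 1 → z * t * z⁻¹ ∈ T → z ∈ H) :
    HasStronglyEmbedded p G := by
  -- `T` is also a Sylow subgroup of `H`, so Sylow's theorem inside `H` provides the conjugating
  -- element.
  have hconj : ∀ y ∈ H, orderOf y = p → ∃ k ∈ H, k * y * k⁻¹ ∈ T := by
    intro y hy hp
    have hY : IsPGroup p (Subgroup.zpowers (⟨y, hy⟩ : H)) := by
      refine IsPGroup.of_card (n := 1) ?_
      rw [Nat.card_zpowers, Subgroup.orderOf_mk, hp, pow_one]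
    obtain ⟨Y, hYle⟩ := hY.exists_le_sylow
    obtain ⟨k, hk⟩ := MulAction.exists_smul_eq H Y (T.subtype hTH)
    refine ⟨k, k.2, ?_⟩
    have hmem : k * ⟨y, hy⟩ * k⁻¹ ∈ T.subtype hTH := by
      rw [← hk]
      exact ⟨_, hYle (Subgroup.mem_zpowers _), rfl⟩
    exact hmem
  refine ⟨H, hH, ?_, fun x hx hdvd => ?_⟩
  · have : p ∣ Nat.card T := by
      obtain ⟨n, hn⟩ := IsPGroup.iff_card.1 T.isPGroup'
      rcases n with - | n
      · exact absurd ((Subgroup.card_eq_one).1 (by simpa using hn)) hT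
      · rw [hn]
        exact dvd_pow_self p n.succ_ne_zero
    exact this.trans (Subgroup.card_dvd_of_le hTH)
  -- Cauchy gives `y = x * y' * x⁻¹` of order `p` with `y` and `y'` in `H`. Moving both into `T` by
  -- `k` and `l` in `H`, the element `k * x * l⁻¹` conjugates a nontrivial element of `T` into `T`.
  · obtain ⟨⟨y, hyH, y', hy'H, hy'⟩, hyp⟩ := exists_prime_orderOf_dvd_card' p hdvd
    replace hyp : orderOf y = p := (Subgroup.orderOf_coe _).trans hyp
    change x * y' * x⁻¹ = y at hy'
    obtain ⟨k, hk, hkT⟩ := hconj y hyH hyp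
    obtain ⟨l, hl, hlT⟩ := hconj y' hy'H (by
      rw [← hyp, ← hy', ← MulAut.conj_apply, MulEquiv.orderOf_eq])
    refine hx ?_
    have hz : k * x * l⁻¹ ∈ H := by
      refine h _ _ hlT (fun h1 => ?_) ?_
      · have h1' : y' = 1 := by simpa using h1
        subst h1'
        subst hy'
        simp only [mul_one, mul_inv_cancel, orderOf_one] at hyp
        exact (Fact.out : p.Prime).one_lt.ne hyp
      · convert hkT using 1
        rw [← hy']
        group
    have : x = k⁻¹ * (k * x * l⁻¹) * l := by group
    rw [this]
    exact H.mul_mem (H.mul_mem (H.inv_mem hk) hz) hl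

namespace FusionSystem

variable {S : Type u} [Group S] (F : FusionSystem S)

/-! ### Isomorphisms, automorphisms and extenders -/

variable {F} in
theorem iso_trans {P Q R : Subgroup S} {φ : P ≃* Q} {ψ : Q ≃* R} (hφ : φ ∈ F.Iso P Q)
    (hψ : ψ ∈ F.Iso Q R) : φ.trans ψ ∈ F.Iso P R :=
  ⟨F.comp_mem hφ.1 hψ.1, F.comp_mem hψ.2 hφ.2⟩

variable {F} in
theorem iso_symm {P Q : Subgroup S} {φ : P ≃* Q} (hφ : φ ∈ F.Iso P Q) : φ.symm ∈ F.Iso Q P :=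
  ⟨hφ.2, hφ.1⟩

variable {F} in
theorem iso_of_mem_aut {P : Subgroup S} {α : MulAut P} (hα : α ∈ F.aut P) : α ∈ F.Iso P P :=
  ⟨hα, (F.aut P).inv_mem hα⟩

theorem inclusion_mem {P Q : Subgroup S} (h : P ≤ Q) : Subgroup.inclusion h ∈ F.Hom P Q := by
  have := F.conj_mem (P := P) (Q := Q) 1 (fun x hx => by simpa using h hx)
  convert this using 1
  ext x
  simp [conjHom]

theorem autS_le_aut (P : Subgroup S) : autS P ≤ F.aut P := by
  rintro _ ⟨g, rfl⟩
  exact F.conj_mem (P := P) (Q := P) g fun x hx => (P.normalizerMonoidHom g ⟨x, hx⟩).2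

theorem innerAut_le_autS (P : Subgroup S) : innerAut P ≤ autS P := by
  rintro _ ⟨g, rfl⟩
  exact ⟨⟨g, Subgroup.le_normalizer g.2⟩, MulEquiv.ext fun _ => rfl⟩

theorem isPGroup_autS {p : ℕ} (hS : IsPGroup p S) (P : Subgroup S) : IsPGroup p (autS P) :=
  (hS.to_subgroup _).of_surjective _ P.normalizerMonoidHom.rangeRestrict_surjective

theorem mem_extender {P Q : Subgroup S} {φ : Q ≃* P} {g : S} :
    g ∈ extender φ ↔ ∃ hg : g ∈ Subgroup.normalizer (Q : Set S),
      MulAut.congr φ (Q.normalizerMonoidHom ⟨g, hg⟩) ∈ autS P := by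
  constructor
  · rintro ⟨⟨g, hg⟩, h, rfl⟩
    exact ⟨hg, h⟩
  · rintro ⟨hg, h⟩
    exact ⟨⟨g, hg⟩, h, rfl⟩

/-- Conjugation by `g ∈ Q`, transported along `φ`, is conjugation by `φ g`. -/
theorem le_extender {P Q : Subgroup S} (φ : Q ≃* P) : Q ≤ extender φ := by
  intro g hg
  refine mem_extender.2 ⟨Subgroup.le_normalizer hg, innerAut_le_autS P ⟨φ ⟨g, hg⟩, ?_⟩⟩
  ext x
  obtain ⟨y, rfl⟩ := φ.surjective x
  have : Q.normalizerMonoidHom ⟨g, Subgroup.le_normalizer hg⟩ y = ⟨g, hg⟩ * y * ⟨g, hg⟩⁻¹ := rfl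
  simp [MulAut.congr, this]

variable {F}

/-- Every conjugate `P` of a fully automized, receptive subgroup `Q` admits an isomorphism onto
`Q` that extends to `N_S(P)`. -/
theorem exists_iso_extends_normalizer [Finite S] {p : ℕ} [Fact p.Prime] (hS : IsPGroup p S)
    {P Q : Subgroup S} (hPQ : F.Conj P Q) (hQ : F.IsFullyAutomized p Q) (hQ' : F.IsReceptive Q) :
    ∃ χ ∈ F.Iso P Q, ∃ ψ ∈ F.Hom (Subgroup.normalizer (P : Set S)) ⊤,
      ∀ (x : S) (hx : x ∈ P) (hx' : x ∈ Subgroup.normalizer (P : Set S)),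
        ((ψ ⟨x, hx'⟩ : (⊤ : Subgroup S)) : S) = χ ⟨x, hx⟩ := by
  obtain ⟨φ, hφ⟩ := hPQ
  obtain ⟨T, hT⟩ := hQ
  let B : Subgroup (MulAut Q) := (autS P).map (MulAut.congr φ).toMonoidHom
  have hB : IsPGroup p (B.subgroupOf (F.aut Q)) :=
    ((isPGroup_autS hS P).map _).comap_of_injective _ (Subgroup.subtype_injective _)
  have hBle : B ≤ F.aut Q := by
    rintro _ ⟨β, hβ, rfl⟩
    exact F.comp_mem (F.comp_mem hφ.2 (F.autS_le_aut P hβ)) hφ.1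
  obtain ⟨T', hT'⟩ := hB.exists_le_sylow
  -- Correcting `φ` by `a` moves the transported copy of Aut_S(P) into Aut_S(Q); the extender is
  -- then all of N_S(P).
  obtain ⟨a, ha⟩ := MulAction.exists_smul_eq (F.aut Q) T' T
  have hχ : φ.trans (a : MulAut Q) ∈ F.Iso P Q := iso_trans hφ (iso_of_mem_aut a.2)
  have hext : extender (φ.trans (a : MulAut Q)) = Subgroup.normalizer (P : Set S) := by
    refine le_antisymm (fun g hg => (mem_extender.1 hg).1) fun g hg => mem_extender.2 ⟨hg, ?_⟩
    have hβB : MulAut.congr φ (P.normalizerMonoidHom ⟨g, hg⟩) ∈ B := ⟨_, ⟨_, rfl⟩, rfl⟩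
    have hmem : a * ⟨_, hBle hβB⟩ * a⁻¹ ∈ (T : Subgroup (F.aut Q)) := by
      rw [← ha]
      exact ⟨_, hT' hβB, rfl⟩
    rw [hT] at hmem
    exact hmem
  obtain ⟨ψ, hψ, hψχ⟩ := hQ' P _ hχ
  exact ⟨_, hχ, _, F.comp_mem (F.inclusion_mem hext.ge) hψ, fun x hx hx' => hψχ x hx _⟩

/-! ### Saturated classes of subgroups -/

/-- The extension to N_S(P) of an isomorphism from P onto `Q` is injective and maps N_S(P) into
N_S(Q). -/
theorem isFullyNormalized_of_isReceptive [Finite S] {p : ℕ} [Fact p.Prime] (hS : IsPGroup p S)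
    {Q : Subgroup S} (hQ : F.IsFullyAutomized p Q) (hQ' : F.IsReceptive Q) :
    F.IsFullyNormalized Q := by
  rintro P ⟨φ, hφ⟩
  obtain ⟨χ, -, ψ, hψ, hψχ⟩ := exists_iso_extends_normalizer hS ⟨_, iso_symm hφ⟩ hQ hQ'
  have hmem : ∀ g : Subgroup.normalizer (P : Set S),
      ((ψ g : (⊤ : Subgroup S)) : S) ∈ Subgroup.normalizer (Q : Set S) := by
    refine fun g => Subgroup.mem_normalizer_fintype fun x hx => ?_
    obtain ⟨y, hy⟩ := χ.surjective ⟨x, hx⟩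
    have hyg : (g : S) * y * (g : S)⁻¹ ∈ P := (Subgroup.mem_normalizer_iff.1 g.2 y).1 y.2
    have h1 := hψχ y y.2 (Subgroup.le_normalizer y.2)
    have h2 := hψχ _ hyg (Subgroup.le_normalizer hyg)
    have h3 : (⟨_, Subgroup.le_normalizer hyg⟩ : Subgroup.normalizer (P : Set S)) =
      g * ⟨y, Subgroup.le_normalizer y.2⟩ * g⁻¹ := rfl
    rw [h3, map_mul, map_mul, map_inv] at h2
    push_cast at h2
    rw [h1, Subtype.coe_eta, hy] at h2
    change _ * x * _ ∈ Q
    rw [h2]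
    exact (χ _).2
  refine Nat.card_le_card_of_injective (fun g => ⟨ψ g, hmem g⟩) fun g h hgh => ?_
  exact F.injective hψ (Subtype.ext (by simpa using hgh))

/-- The extension ψ to N_S(P) carries C_S(P) into C_S(Q) ≤ Q = ψ(P), so injectivity of ψ puts C_S(P)
inside P. -/
theorem isCentric_of_isReceptive [Finite S] {p : ℕ} [Fact p.Prime] (hS : IsPGroup p S)
    {Q : Subgroup S} (hQ : F.IsFullyAutomized p Q) (hQ' : F.IsReceptive Q)
    (hC : Subgroup.centralizer (Q : Set S) ≤ Q) : F.IsCentric Q := by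
  rintro P ⟨φ, hφ⟩
  obtain ⟨χ, -, ψ, hψ, hψχ⟩ := exists_iso_extends_normalizer hS ⟨_, iso_symm hφ⟩ hQ hQ'
  intro g hg
  have hgN : g ∈ Subgroup.normalizer (P : Set S) := Subgroup.centralizer_le_normalizer _ hg
  have hmem : ((ψ ⟨g, hgN⟩ : (⊤ : Subgroup S)) : S) ∈ Q := by
    refine hC (Subgroup.mem_centralizer_iff.2 fun x hx => ?_)
    obtain ⟨y, hy⟩ := χ.surjective ⟨x, hx⟩
    have h1 := hψχ y y.2 (Subgroup.le_normalizer y.2)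
    rw [Subtype.coe_eta, hy] at h1
    change _ = x at h1
    have hcomm : (⟨y, Subgroup.le_normalizer y.2⟩ * ⟨g, hgN⟩ : Subgroup.normalizer (P : Set S)) =
        ⟨g, hgN⟩ * ⟨y, Subgroup.le_normalizer y.2⟩ :=
      Subtype.ext (Subgroup.mem_centralizer_iff.1 hg y y.2)
    have h2 := congrArg (fun z => ((ψ z : (⊤ : Subgroup S)) : S)) hcomm
    simp only [map_mul, Subgroup.coe_mul, h1] at h2
    exact h2
  obtain ⟨y, hy⟩ := χ.surjective ⟨_, hmem⟩
  have h1 := hψχ y y.2 (Subgroup.le_normalizer y.2)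
  rw [Subtype.coe_eta, hy] at h1
  have h2 := F.injective hψ (Subtype.ext h1)
  exact Set.mem_of_eq_of_mem (congrArg Subtype.val h2).symm y.2

/-! ### Morphisms preserving a function of subgroups -/

/-- `φ : P → Q` preserves the function `f` on subgroups of `S`: `f (φ K) = f K` for `K ≤ P`. -/
def Preserves {A : Type*} (f : Subgroup S → A) {P Q : Subgroup S} (φ : P →* Q) : Prop :=
  ∀ K : Subgroup P, f ((K.map φ).map Q.subtype) = f (K.map P.subtype)

section Preserves

variable {A : Type*} {f : Subgroup S → A} {P Q R : Subgroup S}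

theorem Preserves.comp {φ : P →* Q} {ψ : Q →* R} (hψ : Preserves f ψ) (hφ : Preserves f φ) :
    Preserves f (ψ.comp φ) := fun K => by
  rw [← Subgroup.map_map, hψ, hφ]

theorem Preserves.symm {φ : P ≃* Q} (hφ : Preserves f φ.toMonoidHom) :
    Preserves f φ.symm.toMonoidHom := fun K => by
  rw [← hφ, Subgroup.map_map K]
  have : φ.toMonoidHom.comp φ.symm.toMonoidHom = MonoidHom.id Q := by
    ext
    simp
  rw [this, Subgroup.map_id]

/-- This is how information about larger subgroups descends to smaller ones in the induction. -/
theorem Preserves.of_extends {P' Q' : Subgroup S} {φ : P →* Q} {ψ : P' →* Q'}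
    (hψ : Preserves f ψ) (hP : P ≤ P') (h : ∀ x : P, (ψ ⟨x, hP x.2⟩ : S) = φ x) :
    Preserves f φ := fun K => by
  have := hψ (K.map (Subgroup.inclusion hP))
  rw [Subgroup.map_map, Subgroup.map_map K P'.subtype, Subgroup.subtype_comp_inclusion] at this
  rw [Subgroup.map_map]
  have hcomp : Q.subtype.comp φ = (Q'.subtype.comp ψ).comp (Subgroup.inclusion hP) :=
    MonoidHom.ext fun x => (h x).symm
  rw [hcomp, ← Subgroup.map_map]
  exact this

variable (F) in
-- Such an `α` is the restriction of an inner automorphism of S.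
theorem preserves_of_mem_autS (hf : ∀ α ∈ F.aut ⊤, Preserves f (MulEquiv.toMonoidHom α))
    {α : MulAut P} (hα : α ∈ autS P) : Preserves f α.toMonoidHom := by
  obtain ⟨g, rfl⟩ := hα
  refine (hf (MulAut.conj ⟨g, trivial⟩)
    (F.autS_le_aut ⊤ (innerAut_le_autS ⊤ ⟨_, rfl⟩))).of_extends le_top fun x => rfl

end Preserves

/-! ### Alperin's fusion theorem -/

section Alperin

variable {A : Type*} {f : Subgroup S → A}

theorem preserves_of_lt_extender {Q : Subgroup S} (hQ : F.IsReceptive Q)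
    (ih : ∀ R : Subgroup S, Q < R → ∀ R', ∀ ψ ∈ F.Hom R R', Preserves f ψ) {α : MulAut Q}
    (hα : α ∈ F.aut Q) {g : S} (hg : g ∉ Q) (hgα : g ∈ extender α) :
    Preserves f α.toMonoidHom := by
  obtain ⟨ψ, hψ, h⟩ := hQ Q α (iso_of_mem_aut hα)
  exact (ih _ (lt_of_le_of_ne (le_extender α) fun e => hg (e ▸ hgα)) _ ψ hψ).of_extends
    (le_extender α) fun x => h x x.2 _

variable [Finite S] {p : ℕ} [Fact p.Prime]

theorem lt_normalizer (hS : IsPGroup p S) {P : Subgroup S} (hP : P < ⊤) :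
    P < Subgroup.normalizer (P : Set S) :=
  have := hS.isNilpotent
  Group.normalizerCondition_of_isNilpotent P hP

/-- The subgroup of `Aut_F(Q)` of the automorphisms preserving `f`. -/
def preservingAut (F : FusionSystem S) (f : Subgroup S → A) (Q : Subgroup S) :
    Subgroup (MulAut Q) where
  carrier := {α | α ∈ F.aut Q ∧ Preserves f α.toMonoidHom}
  mul_mem' ha hb := ⟨mul_mem ha.1 hb.1, ha.2.comp hb.2⟩
  one_mem' := ⟨one_mem _, fun K => by
    change f ((K.map (MonoidHom.id Q)).map _) = _
    rw [Subgroup.map_id]⟩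
  inv_mem' ha := ⟨inv_mem ha.1, ha.2.symm⟩

/-- The witness is the image of `K`, which contains the Sylow subgroup Out_S(Q) and is proper
because `K` contains Inn(Q). If the class of β conjugates a nontrivial class of c_g into Out_S(Q),
then `g ∉ Q` and g lies in N_β, so `h` puts β in `K`. -/
theorem hasStronglyEmbedded_out (hS : IsPGroup p S) {Q : Subgroup S} (hQtop : Q < ⊤)
    (hQ : F.IsFullyAutomized p Q) (hC : Subgroup.centralizer (Q : Set S) ≤ Q)
    {K : Subgroup (MulAut Q)} (hK : K < F.aut Q) (hSK : autS Q ≤ K)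
    (h : ∀ α ∈ F.aut Q, ∀ g ∉ Q, g ∈ extender α → α ∈ K) : HasStronglyEmbedded p (F.out Q) := by
  obtain ⟨T, hT⟩ := hQ
  have hKI : innerAut Q ≤ K := (innerAut_le_autS Q).trans hSK
  let π : F.aut Q →* F.out Q := (QuotientGroup.mk' (innerAut Q)).subgroupMap (F.aut Q)
  have hπ : Function.Surjective π := MonoidHom.subgroupMap_surjective _ _
  have hπT : ∀ α : F.aut Q, (α : MulAut Q) ∈ autS Q → π α ∈ T.mapSurjective hπ := fun α hα =>
    ⟨α, show α ∈ (T : Subgroup _) by rw [hT]; exact hα, rfl⟩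
  have hTπ : ∀ t ∈ T.mapSurjective hπ, ∃ α : F.aut Q, (α : MulAut Q) ∈ autS Q ∧ π α = t := by
    rintro _ ⟨α, hα, rfl⟩
    exact ⟨α, by change α ∈ (T : Subgroup _) at hα; rwa [hT] at hα, rfl⟩
  have hπ_eq : ∀ α β : F.aut Q, π α = π β ↔ (α : MulAut Q)⁻¹ * β ∈ innerAut Q := fun α β =>
    Subtype.ext_iff.trans QuotientGroup.eq
  let H : Subgroup (F.out Q) := (K.subgroupOf (F.aut Q)).map π
  have hH : ∀ α : F.aut Q, π α ∈ H → (α : MulAut Q) ∈ K := by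
    rintro α ⟨β, hβ, hβα⟩
    have := K.mul_mem hβ (hKI ((hπ_eq _ _).1 hβα))
    simpa using this
  refine HasStronglyEmbedded.of_sylow (T.mapSurjective hπ) ?_ H ?_ ?_ ?_
  -- Out_S(Q) is nontrivial: if c_g agreed with conjugation by some `q` in `Q`, then `q⁻¹ * g` would
  -- centralize `Q`, and `hC` would force `g ∈ Q`.
  · obtain ⟨g, hgN, hg⟩ := SetLike.exists_of_lt (lt_normalizer hS hQtop)
    intro hbot
    let c : F.aut Q := ⟨Q.normalizerMonoidHom ⟨g, hgN⟩, F.autS_le_aut Q ⟨_, rfl⟩⟩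
    have hc : π c = π 1 := by
      have hcT : π c ∈ (T.mapSurjective hπ : Subgroup (F.out Q)) := hπT c ⟨_, rfl⟩
      rw [hbot] at hcT
      exact hcT.trans (map_one π).symm
    obtain ⟨q, hq⟩ := (hπ_eq 1 c).1 hc.symm
    simp only [OneMemClass.coe_one, inv_one, one_mul] at hq
    have hmem : (q : S)⁻¹ * g ∈ Q := by
      refine hC (Subgroup.mem_centralizer_iff.2 fun x hx => ?_)
      have h1 : (q : S) * x * (q : S)⁻¹ = g * x * g⁻¹ :=
        congrArg (fun β : MulAut Q => ((β ⟨x, hx⟩ : Q) : S)) hq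
      rw [mul_inv_eq_iff_eq_mul] at h1
      rw [← mul_right_inj (q : S), ← mul_assoc, h1]
      group
    exact hg (by simpa using Q.mul_mem q.2 hmem)
  · intro t ht
    obtain ⟨α, hα, rfl⟩ := hTπ t ht
    exact ⟨α, hSK hα, rfl⟩
  · refine lt_top_iff_ne_top.2 fun htop => hK.not_ge fun α hα => ?_
    exact hH ⟨α, hα⟩ (htop ▸ Subgroup.mem_top _)
  · intro z t ht ht1 hzt
    obtain ⟨β, rfl⟩ := hπ z
    obtain ⟨⟨_, _⟩, ⟨g, rfl⟩, rfl⟩ := hTπ t ht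
    obtain ⟨γ, hγ, hγz⟩ := hTπ _ hzt
    refine ⟨β, h β β.2 g (fun hg => ht1 ?_) (mem_extender.2 ⟨g.2, ?_⟩), rfl⟩
    · rw [← map_one π, eq_comm, hπ_eq]
      simp only [OneMemClass.coe_one, inv_one, one_mul]
      exact ⟨⟨g, hg⟩, MulEquiv.ext fun _ => rfl⟩
    -- The conjugate of c_g by `β` differs from `γ ∈ autS Q` only by an inner automorphism, and
    -- Inn(Q) ≤ Aut_S(Q).
    · rw [← map_inv, ← map_mul, ← map_mul, hπ_eq] at hγz
      have := (autS Q).mul_mem hγ (innerAut_le_autS Q hγz)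
      rw [mul_inv_cancel_left] at this
      exact this

/-- A function of the subgroups of `S` that is preserved by the `F`-automorphisms of `S` and of
all essential subgroups is preserved by all morphisms of `F`. -/
theorem preserves_of_essential (hS : IsPGroup p S) (hF : F.IsSaturated p)
    (hf : ∀ R : Subgroup S, R = ⊤ ∨ F.IsEssential p R →
      ∀ α ∈ F.aut R, Preserves f (MulEquiv.toMonoidHom α))
    {P P' : Subgroup S} {φ : P →* P'} (hφ : φ ∈ F.Hom P P') : Preserves f φ := by
  -- Inducting on order rather than inclusion lets the hypothesis apply also above the conjugates
  -- `P₁` and `Q` of `P`.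
  induction hn : Nat.card S - Nat.card P using Nat.strong_induction_on generalizing P P' φ with
  | _ n ih =>
  subst hn
  have ih' : ∀ R : Subgroup S, Nat.card P < Nat.card R →
      ∀ R', ∀ ψ ∈ F.Hom R R', Preserves f ψ := fun R hR R' ψ hψ =>
    ih _ (by have := R.card_le_card_group; lia) hψ rfl
  have ihlt : ∀ R : Subgroup S, Nat.card R = Nat.card P → ∀ R₁ : Subgroup S, R < R₁ →
      ∀ R', ∀ ψ ∈ F.Hom R₁ R', Preserves f ψ := fun R hR R₁ hlt =>
    ih' R₁ (hR ▸ Set.ncard_lt_ncard hlt)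
  obtain ⟨P₁, hP₁, e, he, he', rfl⟩ := F.factor hφ
  suffices he : Preserves f e.toMonoidHom from he.of_extends le_rfl fun x => rfl
  have hcard : Nat.card P₁ = Nat.card P := (Nat.card_congr e.toEquiv).symm
  rcases eq_or_lt_of_le (le_top (a := P)) with rfl | hPtop
  · obtain rfl : P₁ = ⊤ := Subgroup.eq_top_of_card_eq _ (by rw [hcard, Subgroup.card_top])
    exact hf ⊤ (Or.inl rfl) e he
  obtain ⟨Q, hPQ, hQ, hQ'⟩ := hF P
  have hQcard : Nat.card Q = Nat.card P :=
    hPQ.elim fun φ _ => (Nat.card_congr φ.toEquiv).symm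
  have lt_top : ∀ R : Subgroup S, Nat.card R = Nat.card P → R < ⊤ := by
    intro R hR
    refine lt_top_iff_ne_top.2 ?_
    rintro rfl
    exact hPtop.ne (Subgroup.eq_top_of_card_eq _ (by rw [← hR, Subgroup.card_top]))
  have key : ∀ R : Subgroup S, Nat.card R = Nat.card P → F.Conj R Q →
      ∃ χ ∈ F.Iso R Q, Preserves f χ.toMonoidHom := by
    intro R hR hRQ
    obtain ⟨χ, hχ, ψ, hψ, h⟩ := exists_iso_extends_normalizer hS hRQ hQ hQ'
    exact ⟨χ, hχ, (ihlt R hR _ (lt_normalizer hS (lt_top R hR)) _ ψ hψ).of_extends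
      Subgroup.le_normalizer fun x => h x x.2 _⟩
  have hauts : ∀ α ∈ F.aut Q, Preserves f (MulEquiv.toMonoidHom α) := by
    have hext : ∀ α ∈ F.aut Q, ∀ g ∉ Q, g ∈ extender α → Preserves f (MulEquiv.toMonoidHom α) :=
      fun α hα g hg hgα => preserves_of_lt_extender hQ' (ihlt Q hQcard) hα hg hgα
    by_cases hC : Subgroup.centralizer (Q : Set S) ≤ Q
    -- If some automorphism failed, `preservingAut F f Q` would be proper, `Q` would be essential,
    -- and `hf` would give a contradiction.
    · by_contra hnot
      refine hnot (hf Q (Or.inr ⟨lt_top Q hQcard, isCentric_of_isReceptive hS hQ hQ' hC,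
        isFullyNormalized_of_isReceptive hS hQ hQ', ?_⟩))
      refine hasStronglyEmbedded_out hS (lt_top Q hQcard) hQ hC (K := preservingAut F f Q)
        (lt_of_le_not_ge (fun α hα => hα.1) fun hle => hnot fun α hα => (hle hα).2)
        (fun α hα => ⟨F.autS_le_aut Q hα, preserves_of_mem_autS F (hf ⊤ (Or.inl rfl)) hα⟩)
        fun α hα g hg hgα => ⟨hα, hext α hα g hg hgα⟩
    -- An element centralizing `Q` induces the identity, so it lies in the extender of every `α`;
    -- being outside `Q`, it makes every extender strictly larger.
    · obtain ⟨g, hgC, hg⟩ := SetLike.not_le_iff_exists.1 hC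
      intro α hα
      refine hext α hα g hg (mem_extender.2 ⟨Subgroup.centralizer_le_normalizer _ hgC, ?_⟩)
      have h1 : Q.normalizerMonoidHom ⟨g, Subgroup.centralizer_le_normalizer _ hgC⟩ = 1 := by
        rw [← MonoidHom.mem_ker, Subgroup.normalizerMonoidHom_ker]
        exact hgC
      rw [h1, map_one]
      exact one_mem _
  obtain ⟨χ, hχ, hχf⟩ := key P rfl hPQ
  obtain ⟨χ', hχ', hχf'⟩ := key P₁ hcard
    (hPQ.elim fun φ hφ => ⟨_, iso_trans (iso_symm ⟨he, he'⟩) hφ⟩)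
  have hα := hauts ((χ.symm.trans e).trans χ')
    (iso_trans (iso_trans (iso_symm hχ) ⟨he, he'⟩) hχ').1
  have heq : e.toMonoidHom = χ'.symm.toMonoidHom.comp
      ((MulEquiv.toMonoidHom ((χ.symm.trans e).trans χ')).comp χ.toMonoidHom) := by
    ext x
    simp
  rw [heq]
  exact hχf'.symm.comp (hα.comp hχf)

end Alperin

/-! ### Stable elements of the Burnside ring -/

/-- Automorphisms act by pullback, the mark of a pullback at `K` is the mark at the image of `K`,
and marks separate elements of B(P). -/
theorem res_mem_subring_iff [Finite S] {b : BurnsideRing S} {P : Subgroup S} :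
    BurnsideRing.res P b ∈ FixedPoints.subring (BurnsideRing P) (F.out P) ↔
      ∀ α ∈ F.aut P, Preserves (fun K => BurnsideRing.mark K b) (MulEquiv.toMonoidHom α) := by
  have hsmul : ∀ (α : MulAut P) (c : BurnsideRing P),
      (QuotientGroup.mk' (innerAut P) α) • c = BurnsideRing.pullback α.symm.toMonoidHom c :=
    fun _ _ => rfl
  have hmem : BurnsideRing.res P b ∈ FixedPoints.subring (BurnsideRing P) (F.out P) ↔
      ∀ α ∈ F.aut P, BurnsideRing.pullback (MulEquiv.toMonoidHom α) (BurnsideRing.res P b) =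
        BurnsideRing.res P b := by
    constructor
    · intro h α hα
      -- The class of an automorphism acts by pullback along its inverse, hence `α⁻¹`.
      exact h ⟨QuotientGroup.mk' (innerAut P) α⁻¹, _, inv_mem hα, rfl⟩
    · rintro h ⟨_, α, hα, rfl⟩
      exact h α⁻¹ (inv_mem hα)
  rw [hmem]
  refine forall₂_congr fun α _ => ⟨fun h K => ?_, fun h => BurnsideRing.eq_of_mark_eq fun K => ?_⟩
  · have := congrArg (BurnsideRing.mark K) h
    rwa [BurnsideRing.mark_pullback, BurnsideRing.res, BurnsideRing.mark_pullback,
      BurnsideRing.mark_pullback] at this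
  · rw [BurnsideRing.mark_pullback, BurnsideRing.res, BurnsideRing.mark_pullback,
      BurnsideRing.mark_pullback]
    exact h K

theorem mem_burnsideRing_of_preserves {b : BurnsideRing S}
    (h : ∀ {P Q : Subgroup S} {φ : P →* Q}, φ ∈ F.Hom P Q →
      Preserves (fun K => BurnsideRing.mark K b) φ) : b ∈ F.burnsideRing := by
  rintro P Q ⟨φ, hφ⟩
  have := h hφ.1 ⊤
  rw [← MonoidHom.range_eq_map, ← MonoidHom.range_eq_map,
    MonoidHom.range_eq_top.2 φ.surjective, ← MonoidHom.range_eq_map, Subgroup.range_subtype,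
    Subgroup.range_subtype] at this
  exact this.symm

/-- Restrict `φ` to `K` and factor it as an isomorphism of F followed by an inclusion; the
intermediate subgroup has to be the image. -/
theorem conj_map {P Q : Subgroup S} {φ : P →* Q} (hφ : φ ∈ F.Hom P Q) (K : Subgroup P) :
    F.Conj (K.map P.subtype) ((K.map φ).map Q.subtype) := by
  have hK : K.map P.subtype ≤ P := Subgroup.map_subtype_le K
  obtain ⟨R, hR, e, he, he', h⟩ := F.factor (F.comp_mem (F.inclusion_mem hK) hφ)
  have hval : ∀ x : P, ∀ hx : (x : S) ∈ K.map P.subtype, (φ x : S) = e ⟨x, hx⟩ := fun x hx =>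
    congrArg Subtype.val (DFunLike.congr_fun h ⟨x, hx⟩)
  obtain rfl : R = (K.map φ).map Q.subtype := by
    ext y
    constructor
    · intro hy
      obtain ⟨⟨_, x, hx, rfl⟩, hxy⟩ := e.surjective ⟨y, hy⟩
      exact ⟨φ x, ⟨x, hx, rfl⟩, (hval x ⟨x, hx, rfl⟩).trans (congrArg Subtype.val hxy)⟩
    · rintro ⟨_, ⟨x, hx, rfl⟩, rfl⟩
      exact Set.mem_of_eq_of_mem (hval x ⟨x, hx, rfl⟩) (e _).2
  exact ⟨e, he, he'⟩

theorem preserves_of_mem_burnsideRing {b : BurnsideRing S} (hb : b ∈ F.burnsideRing)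
    {P Q : Subgroup S} {φ : P →* Q} (hφ : φ ∈ F.Hom P Q) :
    Preserves (fun K => BurnsideRing.mark K b) φ :=
  fun K => (hb _ _ (conj_map hφ K)).symm

end FusionSystem

theorem theorem5p1 {p : ℕ} [Fact p.Prime] {S : Type u} [Group S] [Finite S] (hS : IsPGroup p S)
    (F : FusionSystem S) (hF : F.IsSaturated p) (b : BurnsideRing S) :
    (b ∈ F.burnsideRing ↔
      ∀ P : Subgroup S,
        BurnsideRing.res P b ∈ FixedPoints.subring (BurnsideRing P) (F.out P)) ∧
    (b ∈ F.burnsideRing ↔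
      ∀ R : Subgroup S, R = ⊤ ∨ F.IsEssential p R →
        BurnsideRing.res R b ∈ FixedPoints.subring (BurnsideRing R) (F.out R)) := by
  have hforward : b ∈ F.burnsideRing → ∀ P : Subgroup S,
      BurnsideRing.res P b ∈ FixedPoints.subring (BurnsideRing P) (F.out P) := fun hb P =>
    FusionSystem.res_mem_subring_iff.2 fun α hα => FusionSystem.preserves_of_mem_burnsideRing hb hα
  have hbackward : (∀ R : Subgroup S, R = ⊤ ∨ F.IsEssential p R →
      BurnsideRing.res R b ∈ FixedPoints.subring (BurnsideRing R) (F.out R)) →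
      b ∈ F.burnsideRing := fun h =>
    FusionSystem.mem_burnsideRing_of_preserves fun hφ =>
      FusionSystem.preserves_of_essential hS hF
        (fun R hR => FusionSystem.res_mem_subring_iff.1 (h R hR)) hφ
  -- The condition at all subgroups implies the one at S and the essential subgroups, so a single
  -- converse serves both parts.
  exact ⟨⟨hforward, fun h => hbackward fun R _ => h R⟩,
    ⟨fun hb R _ => hforward hb R, hbackward⟩⟩
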